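/- **Definitions.** Write $[n]=\{1,\dots,n\}$, let $\lg$ be the base-2 logarithm and $\log$ the natural logarithm. A *convex geometry* with finite non-empty ground set $X$ is a family $P$ of subsets of $X$ such that (i) $\emptyset,X\in P$; (ii) $A\cap B\in P$ for all $A,B\in P$; (iii) for every $A\in P$ with $A\ne X$ there is $\alpha\in X\setminus A$ with $A\cup\{\alpha\}\in P$. It is regarded as a poset under inclusion. The poset parameters below are used for finite posets $Q$. - $\operatorname{vcdim}(P)$ is the largest size of a set $S\subseteq X$ such that every subset of $S$ has the form $S\cap A$ with $A\in P$. - $\dim(Q)$ is the least $t\ge1$ for which there are linear extensions $L_1,\dots,L_t$ of $Q$ with: $x\le y$ in $Q$ if and only if $x\le y$ in every $L_i$. - For $t\ge2$ the standard example $S_t$ is the poset on $a_1,\dots,a_t,b_1,\dots,b_t$ whose only strict relations are $a_i<b_j$ for $i\ne j$. $\operatorname{se}(Q)$ is the largest $t\ge2$ such that $S_t$ is isomorphic to a subposet of $Q$, and $\operatorname{se}(Q)=1$ if there is no such $t$. - $\operatorname{bdim}(Q)$ is the least $t\ge1$ for which there are linear orders $L_1,\dots,L_t$ on the ground set of $Q$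 (not necessarily linear extensions) and a set $\tau\subseteq\{0,1\}^t$ such that, for all $x\ne y$, $x<y$ in $Q$ if and only if $(q_1,\dots,q_t)\in\tau$, where $q_i=1$ if $x<y$ in $L_i$ and $q_i=0$ otherwise. - $\operatorname{ldim}(Q)$ is the least $r$ for which there is a finite sequence $M_1,\dots,M_m$ of linear extensions of subposets of $Q$ such that every element of $Q$ occurs in at most $r$ of the $M_i$; whenever $x\le y$ in $Q$, $x\le y$ in some $M_i$; and for every ordered pair $(x,y)$ of incomparable elements, $x>y$ in some $M_j$. - $\operatorname{fdim}(Q)$ is the least real $t\ge1$ such that there is a function $f\ge0$ on the set of linear extensions of $Q$ with $\sum_L f(L)=t$ and $\sum_{L:\,x>y\text{ in }L}f(L)\ge1$ for every ordered pair $(x,y)$ of incomparable elements. - A *linear geometry* with ground set $X$ is the family of all initial segments (including $\emptyset$) of a linear order on $X$. $\operatorname{cdim}(P)$ is the least $t\ge1$ for which there are linear geometries $P_1,\dots,P_t$ with ground set $X$ such that $P=\{A_1\cap\dots\cap A_t: A_i\in P_i\}$. - A class of posets is *dim-bounded* if there is $f:\mathbb N\to\mathbb N$ with $\dim(Q)\le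 f(\operatorname{se}(Q))$ for every $Q$ in the class. **Theorem 1.5.** For all integers $k,n$ with $1\le k\le n-2$ there is a convex geometry $P(k,n)$ with ground set $[n]$ such that: 1. $\operatorname{vcdim}(P(k,n))=\operatorname{se}(P(k,n))=k+1$. 2. $\operatorname{fdim}(P(k,n))<2^{k+1}$. 3. For every fixed $k\ge1$, $\operatorname{bdim}(P(k,n))\to\infty$ as $n\to\infty$. 4. For every fixed $k\ge1$, $\operatorname{ldim}(P(k,n))\to\infty$ as $n\to\infty$. 5. $\dim(P(1,n))=1+\lfloor\lg n\rfloor$ for every $n\ge3$, and $\dim(P(k,n))\le(k+1)2^{k+2}\log n$. 6. $\operatorname{cdim}(P(k,n))=\binom{n-1}{k}$. In particular, for every fixed $k\ge1$, $\dim(P(k,n))\to\infty$ as $n\to\infty$ while $\operatorname{se}(P(k,n))=k+1$ is constant; hence the class of convex geometries is not dim-bounded. -/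

import Mathlib

open Filter

/-! ### Convex geometries -/

/-- A convex geometry with (finite, non-empty) ground set `X`: a family `P` of subsets of `X`
with the base, intersection and extension properties. -/
structure IsConvexGeometry {α : Type*} [DecidableEq α] (X : Finset α) (P : Finset (Finset α)) :
    Prop where
  ground_nonempty : X.Nonempty
  subset_ground : ∀ A ∈ P, A ⊆ X
  empty_mem : ∅ ∈ P
  ground_mem : X ∈ P
  inter_mem : ∀ A ∈ P, ∀ B ∈ P, A ∩ B ∈ P
  extension : ∀ A ∈ P, A ≠ X → ∃ a ∈ X \ A, insert a A ∈ P

/-! ### Linear extensions and dimension -/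

/-- A (reflexive) relation `r` is a linear extension of the poset `α`. -/
def IsLinearExtension {α : Type*} [PartialOrder α] (r : α → α → Prop) : Prop :=
  IsLinearOrder α r ∧ ∀ x y, x ≤ y → r x y

/-- The linear extensions `L 0, …, L (t - 1)` form a realizer of the poset `α`. -/
def IsRealizer {α : Type*} [PartialOrder α] {t : ℕ} (L : Fin t → α → α → Prop) : Prop :=
  (∀ i, IsLinearExtension (L i)) ∧ ∀ x y, x ≤ y ↔ ∀ i, L i x y

/-- The Dushnik-Miller dimension of a finite poset: the least size `t ≥ 1` of a realizer. -/
noncomputable def posetDim (α : Type*) [PartialOrder α] : ℕ :=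
  sInf {t : ℕ | 1 ≤ t ∧ ∃ L : Fin t → α → α → Prop, IsRealizer L}

/-! ### Standard example number -/

/-- The points of the standard example `S_t`. -/
inductive StandardExample (t : ℕ) : Type
  | a (i : Fin t) : StandardExample t
  | b (i : Fin t) : StandardExample t

namespace StandardExample

/-- The order of `S_t`: besides reflexivity, `a i ≤ b j` exactly when `i ≠ j`. -/
protected def le {t : ℕ} : StandardExample t → StandardExample t → Prop
  | a i, a j => i = j
  | b i, b j => i = j
  | a i, b j => i ≠ j
  | b _, a _ => False

instance instPartialOrder (t : ℕ) : PartialOrder (StandardExample t) where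
  le := StandardExample.le
  le_refl x := by cases x <;> rfl
  le_trans x y z hxy hyz := by
    cases x <;> cases y <;> cases z <;> simp_all [StandardExample.le]
  le_antisymm x y hxy hyx := by
    cases x <;> cases y <;> simp_all [StandardExample.le]

end StandardExample

/-- The standard example number of a finite poset: the largest `t ≥ 2` such that the poset contains
`S_t` as a subposet, and `1` if there is no such `t`. -/
noncomputable def standardExampleNumber (α : Type*) [PartialOrder α] : ℕ :=
  sSup ({1} ∪ {t : ℕ | 2 ≤ t ∧ Nonempty (StandardExample t ↪o α)})

/-! ### Boolean dimension -/

/-- The linear orders `L 0, …, L (t - 1)` on the ground set of the poset `α` (not necessarily linear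
extensions) form a Boolean realizer. The query string of a pair of distinct elements `(x, y)` is
`fun i => L i x y`: as `x ≠ y`, its `i`-th entry tells whether `x < y` in `L i`. -/
def IsBooleanRealizer {α : Type*} [PartialOrder α] {t : ℕ} (L : Fin t → α → α → Prop) : Prop :=
  (∀ i, IsLinearOrder α (L i)) ∧
    ∃ τ : Set (Fin t → Prop), ∀ x y : α, x ≠ y → (x < y ↔ (fun i => L i x y) ∈ τ)

/-- The Boolean dimension of a finite poset: the least size `t ≥ 1` of a Boolean realizer. -/
noncomputable def booleanDim (α : Type*) [PartialOrder α] : ℕ :=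
  sInf {t : ℕ | 1 ≤ t ∧ ∃ L : Fin t → α → α → Prop, IsBooleanRealizer L}

/-! ### Local dimension -/

/-- A partial linear extension of the poset `α`: a linear extension of a subposet. -/
structure PartialLinearExtension (α : Type*) [PartialOrder α] where
  carrier : Set α
  le : carrier → carrier → Prop
  isLinearExtension : IsLinearExtension le

/-- `M.Rel x y`: both `x` and `y` occur in `M`, and `x ≤ y` in `M`. -/
def PartialLinearExtension.Rel {α : Type*} [PartialOrder α] (M : PartialLinearExtension α)
    (x y : α) : Prop :=
  ∃ (hx : x ∈ M.carrier) (hy : y ∈ M.carrier), M.le ⟨x, hx⟩ ⟨y, hy⟩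

/-- The sequence of partial linear extensions `M 0, …, M (m - 1)` is a local realizer of `α`. -/
def IsLocalRealizer {α : Type*} [PartialOrder α] {m : ℕ}
    (M : Fin m → PartialLinearExtension α) : Prop :=
  (∀ x y : α, x ≤ y → ∃ i, (M i).Rel x y) ∧
    ∀ x y : α, ¬ x ≤ y → ¬ y ≤ x → ∃ j, (M j).Rel y x

/-- The local dimension of a finite poset: the least `r` for which there is a local realizer such
that every element occurs in at most `r` of its members. -/
noncomputable def localDim (α : Type*) [PartialOrder α] : ℕ :=
  sInf {r : ℕ | ∃ (m : ℕ) (M : Fin m → PartialLinearExtension α), IsLocalRealizer M ∧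
    ∀ x : α, {i : Fin m | x ∈ (M i).carrier}.ncard ≤ r}

/-! ### Fractional dimension -/

/-- The finite set of all linear extensions of a finite poset. -/
noncomputable def linearExtensions (α : Type*) [PartialOrder α] [Finite α] :
    Finset (α → α → Prop) :=
  (Set.toFinite {r : α → α → Prop | IsLinearExtension r}).toFinset

open Classical in
/-- `f` assigns non-negative reals to the linear extensions of `α` such that, for every ordered pair
`(x, y)` of incomparable elements, the linear extensions with `x > y` have total weight at least `1`.
(The values of `f` at other relations play no role.) -/
def IsFractionalRealizer {α : Type*} [PartialOrder α] [Finite α] (f : (α → α → Prop) → ℝ) : Prop :=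
  (∀ L ∈ linearExtensions α, 0 ≤ f L) ∧
    ∀ x y : α, ¬ x ≤ y → ¬ y ≤ x → 1 ≤ ∑ L ∈ linearExtensions α with L y x, f L

/-- The fractional dimension of a finite poset: the least total weight `t ≥ 1` of a
fractional realizer. -/
noncomputable def fractionalDim (α : Type*) [PartialOrder α] [Finite α] : ℝ :=
  sInf {t : ℝ | 1 ≤ t ∧ ∃ f : (α → α → Prop) → ℝ, IsFractionalRealizer f ∧
    ∑ L ∈ linearExtensions α, f L = t}

/-! ### Convex dimension -/

/-- `P` is a linear geometry with ground set `X`: the family of all initial segments (including the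
empty one) of a linear order on `X`, given as the list of the elements of `X` in increasing order. -/
def IsLinearGeometry {α : Type*} [DecidableEq α] (X : Finset α) (P : Finset (Finset α)) : Prop :=
  ∃ l : List α, l.Nodup ∧ l.toFinset = X ∧
    P = (Finset.range (l.length + 1)).image fun i => (l.take i).toFinset

/-- The linear geometries `Q 0, …, Q (t - 1)` with ground set `X` form a convex realizer of `P`, i.e.
`P = {A 0 ∩ ⋯ ∩ A (t - 1) : A i ∈ Q i for all i}`. -/
def IsConvexRealizer {α : Type*} [DecidableEq α] (X : Finset α) (P : Finset (Finset α)) {t : ℕ}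
    (Q : Fin t → Finset (Finset α)) : Prop :=
  (∀ i, IsLinearGeometry X (Q i)) ∧
    ∀ B : Finset α, B ∈ P ↔
      ∃ A : Fin t → Finset α, (∀ i, A i ∈ Q i) ∧ ∀ x, x ∈ B ↔ ∀ i, x ∈ A i

/-- The convex dimension of a convex geometry `P` with ground set `X`: the least size `t ≥ 1` of a
convex realizer. -/
noncomputable def convexDim {α : Type*} [DecidableEq α] (X : Finset α) (P : Finset (Finset α)) : ℕ :=
  sInf {t : ℕ | 1 ≤ t ∧ ∃ Q : Fin t → Finset (Finset α), IsConvexRealizer X P Q}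

/-! ### Dim-boundedness -/

/-- A class `𝒞` of posets is dim-bounded if the dimension of its members is bounded by a function of
their standard example number. -/
def DimBounded (𝒞 : (α : Type) → [PartialOrder α] → Prop) : Prop :=
  ∃ f : ℕ → ℕ, ∀ (α : Type) [PartialOrder α], 𝒞 α → posetDim α ≤ f (standardExampleNumber α)

/-- The class of posets that are (isomorphic to) a convex geometry ordered by inclusion. -/
def IsConvexGeometryPoset (α : Type) [PartialOrder α] : Prop :=
  ∃ (β : Type) (_ : DecidableEq β) (X : Finset β) (P : Finset (Finset β)),
    IsConvexGeometry X P ∧ Nonempty (α ≃o P)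

/-! The geometry `tailGeometry k n` allows at most k elements of A above each missing point. If A ⊄
B, then some x ∈ A \ B has at most k elements of B above it, and any R that contains x and avoids
these elements yields a linear extension putting B below A (`priorityLE_of_mem`). A uniformly random
R does so with probability at least 2^-(k+1). Averaging over R bounds the fractional dimension, a
greedy choice gives O(log n) extensions, and for k = 1 binary digits give an optimal choice.

The lower bounds live on the sets {1, …, a} ∪ {b}, which encode pairs. Reversals inside one
extension give a proper colouring of a shift graph, whence n + 1 ≤ 2^dim
(`add_one_le_two_pow_of_isRealizer`). For Boolean and local dimension, Ramsey's theorem makes all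
crossing pairs a < c < b < d behave alike; the contradiction comes from X crossing Y and Y crossing
Z while X < Z.

A shattered set has at most k + 1 points because its least point can be dropped alone, and in every
convex geometry a standard example yields a shattered set of the same size. For convex dimension,
each k-subset of {2, …, n} must itself belong to some linear geometry of a realizer, and a linear
geometry has only one member of size k; conversely, the orders listing such a subset first form a
realizer. -/

/-! ### Ramsey's theorem for uniform hypergraphs -/

/-- Ramsey's theorem: every colouring of the `d`-subsets of a large enough finite set of natural
numbers has a monochromatic set of size `m`. -/
theorem exists_monochromatic_subset {κ : Type*} [Finite κ] (d m : ℕ) :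
    ∃ N : ℕ, ∀ (S : Finset ℕ) (f : Finset ℕ → κ), N ≤ S.card →
      ∃ H ⊆ S, H.card = m ∧ ∃ c, ∀ s ⊆ H, s.card = d → f s = c := by
  classical
  have := Fintype.ofFinite κ
  induction d generalizing m with
  | zero =>
    refine ⟨m, fun S f hS => ?_⟩
    obtain ⟨H, hHS, hH⟩ := Finset.exists_subset_card_eq hS
    refine ⟨H, hHS, hH, f ∅, fun s _ hs => ?_⟩
    rw [Finset.card_eq_zero.1 hs]
  | succ d ih =>
    -- Colours are first made to depend only on the least element of a set: remove the minimum x,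
    -- apply the case `d` to s ↦ f (insert x s), and recurse inside the set obtained. Pigeonhole on
    -- the colours `g` of the minima then finishes.
    have minHomogeneous : ∀ l : ℕ, ∃ N : ℕ, ∀ (S : Finset ℕ) (f : Finset ℕ → κ), N ≤ S.card →
        ∃ T ⊆ S, T.card = l ∧ ∃ g : ℕ → κ, ∀ s ⊆ T, s.card = d + 1 →
          ∀ x ∈ s, (∀ y ∈ s, x ≤ y) → f s = g x := by
      intro l
      induction l with
      | zero =>
        refine ⟨0, fun S f _ => ⟨∅, by simp, rfl, fun _ => f ∅, fun s hs hc => ?_⟩⟩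
        rw [Finset.subset_empty.1 hs] at hc
        simp at hc
      | succ l ihl =>
        obtain ⟨N, hN⟩ := ihl
        obtain ⟨N', hN'⟩ := ih N
        refine ⟨N' + 1, fun S f hS => ?_⟩
        have hne : S.Nonempty := Finset.card_pos.1 (by omega)
        set x := S.min' hne with hx
        have hxS : x ∈ S := S.min'_mem hne
        obtain ⟨H, hHS, hH, c, hc⟩ := hN' (S.erase x) (fun s => f (insert x s))
          (by rw [Finset.card_erase_of_mem hxS]; omega)
        obtain ⟨T, hTH, hT, g, hg⟩ := hN H f hH.ge
        have hxT : x ∉ T := fun h => Finset.notMem_erase x S (hHS (hTH h))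
        have hlt : ∀ y ∈ T, x < y := fun y hy => by
          have hyS := hHS (hTH hy)
          exact lt_of_le_of_ne (S.min'_le y (Finset.mem_of_mem_erase hyS))
            (Finset.ne_of_mem_erase hyS).symm
        refine ⟨insert x T, Finset.insert_subset hxS
          (hTH.trans (hHS.trans (Finset.erase_subset _ _))), by
          rw [Finset.card_insert_of_notMem hxT, hT], fun y => if y = x then c else g y, ?_⟩
        intro s hs hcard y hy hmin
        by_cases hxs : x ∈ s
        · have hyx : y = x := by
            rcases Finset.mem_insert.1 (hs hy) with h | h
            · exact h
            · exact absurd (hmin x hxs) (not_le.2 (hlt y h))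
          simp only [if_pos hyx]
          have h := hc (s.erase x) (fun z hz => by
            rcases Finset.mem_insert.1 (hs (Finset.mem_of_mem_erase hz)) with h | h
            · exact absurd h (Finset.ne_of_mem_erase hz)
            · exact hTH h) (by rw [Finset.card_erase_of_mem hxs]; omega)
          simpa [Finset.insert_erase hxs] using h
        · have hyx : y ≠ x := fun h => hxs (h ▸ hy)
          simp only [if_neg hyx]
          exact hg s ((Finset.subset_insert_iff_of_notMem hxs).1 hs) hcard y hy hmin
    obtain ⟨N, hN⟩ := minHomogeneous (Fintype.card κ * m + 1)
    refine ⟨N, fun S f hS => ?_⟩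
    obtain ⟨T, hTS, hT, g, hg⟩ := hN S f hS
    obtain ⟨c, -, hc⟩ := Finset.exists_lt_card_fiber_of_mul_lt_card_of_maps_to
      (s := T) (t := Finset.univ) (f := g) (n := m) (by simp)
      (by rw [hT, Finset.card_univ]; omega)
    obtain ⟨H, hHT, hH⟩ := Finset.exists_subset_card_eq hc.le
    refine ⟨H, (hHT.trans (Finset.filter_subset _ _)).trans hTS, hH, c, fun s hs hcard => ?_⟩
    have hne : s.Nonempty := Finset.card_pos.1 (by omega)
    rw [hg s ((hs.trans hHT).trans (Finset.filter_subset _ _)) hcard _ (s.min'_mem hne)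
      (fun y hy => s.min'_le y hy)]
    exact (Finset.mem_filter.1 (hHT (hs (s.min'_mem hne)))).2

/-- The form of Ramsey's theorem for increasing quadruples in `{1, …, n}`. -/
theorem exists_increasing_monochromatic {κ : Type*} [Finite κ] (m : ℕ) :
    ∃ N : ℕ, ∀ n ≥ N, ∀ f : ℕ → ℕ → ℕ → ℕ → κ, ∃ p : ℕ → ℕ,
      (∀ i < m, p i ∈ Finset.Icc 1 n) ∧ (∀ i j, i < j → j < m → p i < p j) ∧
      ∃ c, ∀ i₁ i₂ i₃ i₄, i₁ < i₂ → i₂ < i₃ → i₃ < i₄ → i₄ < m →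
        f (p i₁) (p i₂) (p i₃) (p i₄) = c := by
  classical
  obtain ⟨N, hN⟩ := exists_monochromatic_subset (κ := κ) 4 m
  refine ⟨N, fun n hn f => ?_⟩
  -- A 4-set is coloured through its sorted list; the default 0 is never read, since only 4-sets
  -- matter.
  obtain ⟨H, hHS, hH, c, hc⟩ := hN (Finset.Icc 1 n)
    (fun s => f ((s.sort (· ≤ ·)).getD 0 0) ((s.sort (· ≤ ·)).getD 1 0)
      ((s.sort (· ≤ ·)).getD 2 0) ((s.sort (· ≤ ·)).getD 3 0)) (by simpa using hn)
  have hmem : ∀ i (hi : i < m), H.orderEmbOfFin hH ⟨i, hi⟩ ∈ H :=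
    fun i hi => H.orderEmbOfFin_mem hH _
  refine ⟨fun i => if hi : i < m then H.orderEmbOfFin hH ⟨i, hi⟩ else 0, fun i hi => ?_,
    fun i j hij hj => ?_, c, fun i₁ i₂ i₃ i₄ h₁ h₂ h₃ h₄ => ?_⟩
  · simp only [hi, dif_pos]
    exact hHS (hmem i hi)
  · simp only [hij.trans hj, hj, dif_pos]
    exact (H.orderEmbOfFin hH).strictMono hij
  · have i₃m := h₃.trans h₄
    have i₂m := h₂.trans i₃m
    have i₁m := h₁.trans i₂m
    simp only [i₁m, i₂m, i₃m, h₄, dif_pos]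
    have hlt₁ := (H.orderEmbOfFin hH).strictMono (show (⟨i₁, i₁m⟩ : Fin m) < ⟨i₂, i₂m⟩ from h₁)
    have hlt₂ := (H.orderEmbOfFin hH).strictMono (show (⟨i₂, i₂m⟩ : Fin m) < ⟨i₃, i₃m⟩ from h₂)
    have hlt₃ := (H.orderEmbOfFin hH).strictMono (show (⟨i₃, i₃m⟩ : Fin m) < ⟨i₄, h₄⟩ from h₃)
    have m₁ := hmem i₁ i₁m
    have m₂ := hmem i₂ i₂m
    have m₃ := hmem i₃ i₃m
    have m₄ := hmem i₄ h₄
    generalize H.orderEmbOfFin hH ⟨i₁, i₁m⟩ = a at *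
    generalize H.orderEmbOfFin hH ⟨i₂, i₂m⟩ = b at *
    generalize H.orderEmbOfFin hH ⟨i₃, i₃m⟩ = e at *
    generalize H.orderEmbOfFin hH ⟨i₄, h₄⟩ = g at *
    have hsort : (({a, b, e, g} : Finset ℕ).sort (· ≤ ·)) = [a, b, e, g] := by
      rw [Finset.sort_insert _ (by simp; omega) (by simp; omega),
        Finset.sort_insert _ (by simp; omega) (by simp; omega),
        Finset.sort_insert _ (by simp; omega) (by simp; omega), Finset.sort_singleton]
    have h := hc {a, b, e, g} (by
      intro z hz
      simp only [Finset.mem_insert, Finset.mem_singleton] at hz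
      rcases hz with rfl | rfl | rfl | rfl <;> assumption) (by
      rw [← Finset.length_sort (· ≤ ·), hsort]; rfl)
    rw [hsort] at h
    simpa using h

/-! ### Two counting arguments -/

/-- A proper colouring of the shift graph on the pairs from `{1, …, N}` with `t` colours
forces `N ≤ 2 ^ t`. -/
theorem le_two_pow_of_shift_coloring {κ : Type*} [Fintype κ] {N : ℕ} (c : ℕ → ℕ → κ)
    (h : ∀ x y z, 1 ≤ x → x < y → y < z → z ≤ N → c x y ≠ c y z) :
    N ≤ 2 ^ Fintype.card κ := by
  classical
  -- The colours of the pairs with lower end x. The colour of (x, y) lies in φ x but, by properness,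
  -- not in φ y, so φ is injective.
  let φ : ℕ → Finset κ := fun x => (Finset.Ioc x N).image (c x)
  have key : ∀ x y, 1 ≤ x → x < y → y ≤ N → φ x ≠ φ y := by
    intro x y hx hxy hy heq
    have hmem : c x y ∈ φ x := Finset.mem_image.2 ⟨y, Finset.mem_Ioc.2 ⟨hxy, hy⟩, rfl⟩
    rw [heq] at hmem
    obtain ⟨z, hz, hcz⟩ := Finset.mem_image.1 hmem
    rw [Finset.mem_Ioc] at hz
    exact h x y z hx hxy hz.1 hz.2 hcz.symm
  have hcard := Finset.card_le_card_of_injOn (s := Finset.Icc 1 N)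
    (t := (Finset.univ : Finset (Finset κ))) φ (by simp) (by
      intro x hx y hy hxy
      simp only [Finset.coe_Icc, Set.mem_Icc] at hx hy
      rcases lt_trichotomy x y with hlt | heq | hlt
      · exact absurd hxy (key x y hx.1 hlt hy.2)
      · exact heq
      · exact absurd hxy.symm (key y x hy.1 hlt hx.2))
  simpa using hcard

/-- Greedy covering: if every demand is satisfied by a proportion of at least `p` of the options,
then some `t` options leave at most a proportion of `(1 - p) ^ t` of the demands unsatisfied. -/
theorem exists_options_card_unsatisfied_le {Ω D : Type*} (opts : Finset Ω) (hopts : opts.Nonempty)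
    (dem : Finset D) (sat : Ω → D → Prop) [∀ ω d, Decidable (sat ω d)] {p : ℝ} (hp : p ≤ 1)
    (h : ∀ d ∈ dem, p * opts.card ≤ (opts.filter fun ω => sat ω d).card) (t : ℕ) :
    ∃ w : Fin t → Ω, (∀ i, w i ∈ opts) ∧
      ((dem.filter fun d => ∀ i, ¬ sat (w i) d).card : ℝ) ≤ (1 - p) ^ t * dem.card := by
  induction t with
  | zero => exact ⟨Fin.elim0, fun i => i.elim0, by simp⟩
  | succ t ih =>
    obtain ⟨w, hw, hle⟩ := ih
    set rest := dem.filter fun d => ∀ i, ¬ sat (w i) d with hrest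
    -- Double counting of satisfied (option, demand) incidences: some option does at least as well
    -- as the average.
    obtain ⟨ω, hω, hsat⟩ : ∃ ω ∈ opts, p * rest.card ≤ ((rest.filter (sat ω)).card : ℝ) := by
      refine Finset.exists_le_of_sum_le hopts ?_
      have hcount := Finset.sum_card_bipartiteAbove_eq_sum_card_bipartiteBelow sat
        (s := opts) (t := rest)
      simp only [Finset.bipartiteAbove, Finset.bipartiteBelow] at hcount
      rw [← Nat.cast_sum, hcount, Nat.cast_sum, Finset.sum_const, nsmul_eq_mul]
      calc (opts.card : ℝ) * (p * rest.card) = ∑ _d ∈ rest, p * (opts.card : ℝ) := by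
            rw [Finset.sum_const, nsmul_eq_mul]; ring
        _ ≤ _ := Finset.sum_le_sum fun d hd => h d (Finset.mem_filter.1 hd).1
    refine ⟨Fin.cons ω w, fun i => ?_, ?_⟩
    · induction i using Fin.cases with
      | zero => simpa using hω
      | succ i => simpa using hw i
    · have heq : (dem.filter fun d => ∀ i, ¬ sat ((Fin.cons ω w : Fin (t + 1) → Ω) i) d) =
          rest.filter fun d => ¬ sat ω d := by
        ext d
        simp only [hrest, Finset.mem_filter, Fin.forall_fin_succ, Fin.cons_zero, Fin.cons_succ]
        tauto
      have hsplit := Finset.card_filter_add_card_filter_not (s := rest) (sat ω)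
      have hsplit' : ((rest.filter (sat ω)).card : ℝ) +
          ((rest.filter fun d => ¬ sat ω d).card : ℝ) = rest.card := by exact_mod_cast hsplit
      rw [heq, pow_succ]
      nlinarith [mul_le_mul_of_nonneg_left hle (sub_nonneg.2 hp)]

/-! ### Linear extensions and realizers -/

theorem IsLinearExtension.of_monotone_injective {α β : Type*} [PartialOrder α] [LinearOrder β]
    {f : α → β} (hf : Monotone f) (hinj : Function.Injective f) :
    IsLinearExtension fun x y => f x ≤ f y :=
  ⟨{ refl := fun _ => le_rfl
     trans := fun _ _ _ => le_trans
     antisymm := fun _ _ h h' => hinj (le_antisymm h h')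
     total := fun _ _ => le_total _ _ }, fun _ _ h => hf h⟩

/-- Realizers from reversals of the pairs `x ≰ y`. -/
theorem isRealizer_of_forall_not_le {α : Type*} [PartialOrder α] {t : ℕ}
    {L : Fin t → α → α → Prop} (hL : ∀ i, IsLinearExtension (L i))
    (h : ∀ x y, ¬ x ≤ y → ∃ i, L i y x) : IsRealizer L := by
  refine ⟨hL, fun x y => ⟨fun hxy i => (hL i).2 x y hxy, fun hall => ?_⟩⟩
  by_contra hxy
  obtain ⟨i, hi⟩ := h x y hxy
  exact hxy ((hL i).1.antisymm _ _ (hall i) hi ▸ le_rfl)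

theorem IsRealizer.exists_rel {α : Type*} [PartialOrder α] {t : ℕ} {L : Fin t → α → α → Prop}
    (hL : IsRealizer L) {x y : α} (h : ¬ x ≤ y) : ∃ i, L i y x := by
  obtain ⟨i, hi⟩ := not_forall.1 fun hall => h ((hL.2 x y).2 hall)
  exact ⟨i, ((hL.1 i).1.total y x).resolve_right hi⟩

theorem IsRealizer.isBooleanRealizer {α : Type*} [PartialOrder α] {t : ℕ}
    {L : Fin t → α → α → Prop} (hL : IsRealizer L) : IsBooleanRealizer L :=
  ⟨fun i => (hL.1 i).1, {fun _ => True}, fun x y hne => by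
    rw [Set.mem_singleton_iff, funext_iff, lt_iff_le_and_ne, hL.2 x y]
    simp [hne]⟩

/-- A linear extension of the whole poset. -/
def IsLinearExtension.toPartial {α : Type*} [PartialOrder α] {r : α → α → Prop}
    (hr : IsLinearExtension r) : PartialLinearExtension α where
  carrier := Set.univ
  le x y := r x y
  isLinearExtension :=
    ⟨{ refl := fun x => hr.1.refl x.1
       trans := fun x y z => hr.1.trans x.1 y.1 z.1
       antisymm := fun x y h h' => Subtype.ext (hr.1.antisymm x.1 y.1 h h')
       total := fun x y => hr.1.total x.1 y.1 }, fun x y h => hr.2 x.1 y.1 h⟩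

theorem IsRealizer.isLocalRealizer {α : Type*} [PartialOrder α] {t : ℕ}
    {L : Fin t → α → α → Prop} (hL : IsRealizer L) (ht : 1 ≤ t) :
    IsLocalRealizer fun i => (hL.1 i).toPartial := by
  refine ⟨fun x y h => ⟨⟨0, ht⟩, trivial, trivial, (hL.1 _).2 x y h⟩, fun x y h _ => ?_⟩
  obtain ⟨i, hi⟩ := hL.exists_rel h
  exact ⟨i, trivial, trivial, hi⟩

theorem posetDim_le {α : Type*} [PartialOrder α] {t : ℕ} (ht : 1 ≤ t)
    {L : Fin t → α → α → Prop} (hL : IsRealizer L) : posetDim α ≤ t :=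
  Nat.sInf_le ⟨ht, L, hL⟩

/-- The infimum of an empty set of naturals is 0, so lower bounds need some realizer to exist before
the infimum is known to be attained. The Boolean and local analogues start from the same realizer.
-/
theorem exists_isRealizer_posetDim {α : Type*} [PartialOrder α] {t : ℕ} (ht : 1 ≤ t)
    {L : Fin t → α → α → Prop} (hL : IsRealizer L) :
    ∃ L' : Fin (posetDim α) → α → α → Prop, IsRealizer L' :=
  (Nat.sInf_mem (s := {t : ℕ | 1 ≤ t ∧ ∃ L : Fin t → α → α → Prop, IsRealizer L})
    ⟨t, ht, L, hL⟩).2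

theorem exists_isBooleanRealizer_booleanDim {α : Type*} [PartialOrder α] {t : ℕ} (ht : 1 ≤ t)
    {L : Fin t → α → α → Prop} (hL : IsRealizer L) :
    ∃ L' : Fin (booleanDim α) → α → α → Prop, IsBooleanRealizer L' :=
  (Nat.sInf_mem (s := {t : ℕ | 1 ≤ t ∧ ∃ L : Fin t → α → α → Prop, IsBooleanRealizer L})
    ⟨t, ht, L, hL.isBooleanRealizer⟩).2

theorem exists_isLocalRealizer_localDim {α : Type*} [PartialOrder α] {t : ℕ} (ht : 1 ≤ t)
    {L : Fin t → α → α → Prop} (hL : IsRealizer L) :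
    ∃ (m : ℕ) (M : Fin m → PartialLinearExtension α), IsLocalRealizer M ∧
      ∀ x : α, {i : Fin m | x ∈ (M i).carrier}.ncard ≤ localDim α :=
  Nat.sInf_mem (s := {r : ℕ | ∃ (m : ℕ) (M : Fin m → PartialLinearExtension α),
    IsLocalRealizer M ∧ ∀ x : α, {i : Fin m | x ∈ (M i).carrier}.ncard ≤ r})
    ⟨t, t, _, hL.isLocalRealizer ht, fun x => by
      simpa using Set.ncard_le_ncard (Set.subset_univ {i : Fin t | x ∈ ((hL.1 i).toPartial).carrier})⟩

/-- A sequence of natural numbers tends to infinity if every value is eventually avoided. -/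
theorem tendsto_atTop_of_eventually_ne {u : ℕ → ℕ} (h : ∀ t, ∀ᶠ n in atTop, u n ≠ t) :
    Tendsto u atTop atTop := by
  refine tendsto_atTop.2 fun t => ?_
  filter_upwards [(Set.finite_Iio t).eventually_all.2 fun s _ => h s] with n hn
  by_contra hlt
  exact hn (u n) (not_le.1 hlt) rfl

/-! ### The geometries -/

open Classical in
/-- The subsets `A` of `{1, …, n}` with at most `k` elements above the least element missing
from `A`. -/
noncomputable def tailGeometry (k n : ℕ) : Finset (Finset ℕ) :=
  (Finset.Icc 1 n).powerset.filter fun A =>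
    ∀ x ∈ Finset.Icc 1 n, x ∉ A → (A.filter (x < ·)).card ≤ k

theorem mem_tailGeometry {k n : ℕ} {A : Finset ℕ} : A ∈ tailGeometry k n ↔
    A ⊆ Finset.Icc 1 n ∧ ∀ x ∈ Finset.Icc 1 n, x ∉ A → (A.filter (x < ·)).card ≤ k := by
  simp only [tailGeometry, Finset.mem_filter, Finset.mem_powerset]

theorem ground_mem_tailGeometry (k n : ℕ) : Finset.Icc 1 n ∈ tailGeometry k n :=
  mem_tailGeometry.2 ⟨subset_rfl, fun _ h h' => absurd h h'⟩

theorem isConvexGeometry_tailGeometry (k : ℕ) {n : ℕ} (hn : 1 ≤ n) :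
    IsConvexGeometry (Finset.Icc 1 n) (tailGeometry k n) where
  ground_nonempty := Finset.nonempty_Icc.2 hn
  subset_ground A hA := (mem_tailGeometry.1 hA).1
  empty_mem := mem_tailGeometry.2 (by simp)
  ground_mem := ground_mem_tailGeometry k n
  inter_mem A hA B hB := by
    rw [mem_tailGeometry] at *
    refine ⟨Finset.inter_subset_left.trans hA.1, fun x hx hxAB => ?_⟩
    by_cases hxA : x ∈ A
    · have hxB : x ∉ B := fun h => hxAB (Finset.mem_inter.2 ⟨hxA, h⟩)
      exact (Finset.card_le_card (Finset.filter_subset_filter _ Finset.inter_subset_right)).trans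
        (hB.2 x hx hxB)
    · exact (Finset.card_le_card (Finset.filter_subset_filter _ Finset.inter_subset_left)).trans
        (hA.2 x hx hxA)
  extension A hA hne := by
    rw [mem_tailGeometry] at hA
    -- The least missing element is added: every point still missing lies above it, so no count
    -- grows.
    have hd : (Finset.Icc 1 n \ A).Nonempty :=
      Finset.sdiff_nonempty.2 fun h => hne (subset_antisymm hA.1 h)
    have hmem := Finset.min'_mem _ hd
    refine ⟨_, hmem, mem_tailGeometry.2
      ⟨Finset.insert_subset (Finset.mem_sdiff.1 hmem).1 hA.1, fun x hx hxA => ?_⟩⟩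
    rw [Finset.mem_insert, not_or] at hxA
    have hle := Finset.min'_le _ x (Finset.mem_sdiff.2 ⟨hx, hxA.2⟩)
    rw [Finset.filter_insert, if_neg (not_lt.2 hle)]
    exact hA.2 x hx hxA.2

/-! ### VC-dimension and standard example number -/

theorem mem_tailGeometry_of_subset_Icc {k n : ℕ} (hkn : k + 1 ≤ n) {A : Finset ℕ}
    (hA : A ⊆ Finset.Icc 1 (k + 1)) : A ∈ tailGeometry k n := by
  refine mem_tailGeometry.2 ⟨hA.trans (Finset.Icc_subset_Icc_right hkn), fun x hx _ => ?_⟩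
  rw [Finset.mem_Icc] at hx
  have hsub : A.filter (x < ·) ⊆ Finset.Ioc x (k + 1) := fun y hy => by
    rw [Finset.mem_filter] at hy
    exact Finset.mem_Ioc.2 ⟨hy.2, (Finset.mem_Icc.1 (hA hy.1)).2⟩
  have := Finset.card_le_card hsub
  rw [Nat.card_Ioc] at this
  omega

/-- With x the least point of S, a member tracing S \ {x} misses x and has at least |S| - 1 elements
above it. -/
theorem card_le_of_shatters {k n : ℕ} {S : Finset ℕ} (hS : (tailGeometry k n).Shatters S) :
    S.card ≤ k + 1 := by
  rcases S.eq_empty_or_nonempty with rfl | hne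
  · simp
  have hmin := S.min'_mem hne
  set x := S.min' hne
  obtain ⟨A, hA, hSA⟩ := hS (Finset.erase_subset x S)
  obtain ⟨B, hB, hSB⟩ := hS (subset_refl S)
  have hxA : x ∉ A := fun h => Finset.notMem_erase x S (hSA ▸ Finset.mem_inter.2 ⟨hmin, h⟩)
  have hxX : x ∈ Finset.Icc 1 n :=
    (mem_tailGeometry.1 hB).1 (Finset.mem_of_mem_inter_right (hSB.symm ▸ hmin))
  have hle := (mem_tailGeometry.1 hA).2 x hxX hxA
  have hsub : S.erase x ⊆ A.filter (x < ·) := fun y hy =>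
    Finset.mem_filter.2 ⟨Finset.mem_of_mem_inter_right (hSA.symm ▸ hy),
      lt_of_le_of_ne (S.min'_le y (Finset.mem_of_mem_erase hy)) (Finset.ne_of_mem_erase hy).symm⟩
  have := (Finset.card_le_card hsub).trans hle
  rw [Finset.card_erase_of_mem hmin] at this
  omega

theorem shatters_Icc_tailGeometry {k n : ℕ} (hkn : k + 1 ≤ n) :
    (tailGeometry k n).Shatters (Finset.Icc 1 (k + 1)) :=
  fun A hA => ⟨A, mem_tailGeometry_of_subset_Icc hkn hA, Finset.inter_eq_right.2 hA⟩

theorem vcDim_tailGeometry {k n : ℕ} (hkn : k + 1 ≤ n) : (tailGeometry k n).vcDim = k + 1 := by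
  refine le_antisymm (Finset.sup_le fun S hS => card_le_of_shatters (Finset.mem_shatterer.1 hS)) ?_
  have := (shatters_Icc_tailGeometry hkn).card_le_vcDim
  simpa using this

/-- In a convex geometry, a standard example yields a shattered set of the same size. -/
theorem IsConvexGeometry.exists_shatters_card_eq {α : Type*} [DecidableEq α] {X : Finset α}
    {P : Finset (Finset α)} (hP : IsConvexGeometry X P) {t : ℕ} (f : StandardExample t ↪o P) :
    ∃ S, P.Shatters S ∧ S.card = t := by
  have hex : ∀ i, ∃ x ∈ (f (.a i)).1, x ∉ (f (.b i)).1 := fun i => by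
    have h : ¬ f (.a i) ≤ f (.b i) := fun h => (f.le_iff_le.1 h : i ≠ i) rfl
    exact Finset.not_subset.1 h
  choose x hxa hxb using hex
  have hmem : ∀ i j, x i ∈ (f (.b j)).1 ↔ i ≠ j := fun i j => by
    refine ⟨fun h hij => hxb i (hij ▸ h), fun h => ?_⟩
    have hle : f (.a i) ≤ f (.b j) := f.le_iff_le.2 h
    exact hle (hxa i)
  have hinj : Function.Injective x := fun i j hij => by
    by_contra hne
    exact hxb j (hij ▸ (hmem i j).2 hne)
  have hxX : ∀ i, x i ∈ X := fun i => hP.subset_ground _ (f (.a i)).2 (hxa i)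
  refine ⟨Finset.univ.image x, fun U hU => ?_, by simp [Finset.card_image_of_injective _ hinj]⟩
  -- Since x i ∈ b j exactly when i ≠ j, intersecting the b j over j ∈ s removes precisely the
  -- points indexed by s; the ground set serves as the empty intersection.
  have hinter : ∀ s : Finset (Fin t), ∃ A ∈ P, ∀ i, x i ∈ A ↔ i ∉ s := fun s => by
    induction s using Finset.induction_on with
    | empty => exact ⟨X, hP.ground_mem, fun i => by simp [hxX]⟩
    | insert j s _ ih =>
      obtain ⟨A, hA, hiff⟩ := ih
      refine ⟨(f (.b j)).1 ∩ A, hP.inter_mem _ (f (.b j)).2 _ hA, fun i => ?_⟩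
      simp [hmem, hiff]
  obtain ⟨A, hA, hiff⟩ := hinter (Finset.univ.filter fun i => x i ∉ U)
  refine ⟨A, hA, ?_⟩
  ext y
  simp only [Finset.mem_inter, Finset.mem_image, Finset.mem_univ, true_and]
  constructor
  · rintro ⟨⟨i, rfl⟩, hi⟩
    simpa using (hiff i).1 hi
  · intro hy
    obtain ⟨i, -, rfl⟩ := Finset.mem_image.1 (hU hy)
    exact ⟨⟨i, rfl⟩, (hiff i).2 (by simpa using hy)⟩

/-- As 1 is present, a missing point is at least 2, leaving at most k points of {1, …, k + 2} above
it. -/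
theorem mem_tailGeometry_of_one_mem {k n : ℕ} (hkn : k + 2 ≤ n) {A : Finset ℕ}
    (hA : A ⊆ Finset.Icc 1 (k + 2)) (h1 : 1 ∈ A) : A ∈ tailGeometry k n := by
  refine mem_tailGeometry.2 ⟨hA.trans (Finset.Icc_subset_Icc_right hkn), fun x hx hxA => ?_⟩
  rw [Finset.mem_Icc] at hx
  have hx1 : x ≠ 1 := fun h => hxA (h ▸ h1)
  have hsub : A.filter (x < ·) ⊆ Finset.Ioc x (k + 2) := fun y hy => by
    rw [Finset.mem_filter] at hy
    exact Finset.mem_Ioc.2 ⟨hy.2, (Finset.mem_Icc.1 (hA hy.1)).2⟩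
  have := Finset.card_le_card hsub
  rw [Nat.card_Ioc] at this
  omega

theorem singleton_mem_tailGeometry {k n x : ℕ} (hk : 1 ≤ k) (hx : x ∈ Finset.Icc 1 n) :
    {x} ∈ tailGeometry k n :=
  mem_tailGeometry.2 ⟨Finset.singleton_subset_iff.2 hx, fun _ _ _ =>
    ((Finset.card_filter_le _ _).trans (Finset.card_singleton x).le).trans hk⟩

/-- The standard example formed by the singletons of `2, …, k + 2` and their complements
in `{1, …, k + 2}`. -/
theorem nonempty_standardExample_embedding {k n : ℕ} (hk : 1 ≤ k) (hkn : k + 2 ≤ n) :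
    Nonempty (StandardExample (k + 1) ↪o tailGeometry k n) := by
  have hpt : ∀ i : Fin (k + 1), i.1 + 2 ∈ Finset.Icc 1 (k + 2) := fun i =>
    Finset.mem_Icc.2 ⟨by omega, by omega⟩
  -- The point 1 in every b i keeps b i in the geometry and prevents b i ⊆ a j.
  have h1 : ∀ i : Fin (k + 1), 1 ∈ (Finset.Icc 1 (k + 2)).erase (i.1 + 2) := fun i => by
    simp
  let f : StandardExample (k + 1) → tailGeometry k n
    | .a i => ⟨{i.1 + 2}, singleton_mem_tailGeometry hk
        (Finset.Icc_subset_Icc_right hkn (hpt i))⟩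
    | .b i => ⟨(Finset.Icc 1 (k + 2)).erase (i.1 + 2), mem_tailGeometry_of_one_mem hkn
        (Finset.erase_subset _ _) (h1 i)⟩
  refine ⟨OrderEmbedding.ofMapLEIff f fun u v => ?_⟩
  rcases u with i | i <;> rcases v with j | j
  · change ({i.1 + 2} : Finset ℕ) ⊆ {j.1 + 2} ↔ i = j
    simp [Fin.ext_iff]
  · change ({i.1 + 2} : Finset ℕ) ⊆ (Finset.Icc 1 (k + 2)).erase (j.1 + 2) ↔ i ≠ j
    simp [Fin.ext_iff]
    omega
  · change (Finset.Icc 1 (k + 2)).erase (i.1 + 2) ⊆ ({j.1 + 2} : Finset ℕ) ↔ False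
    refine ⟨fun h => ?_, False.elim⟩
    have := Finset.mem_singleton.1 (h (h1 i))
    omega
  · change (Finset.Icc 1 (k + 2)).erase (i.1 + 2) ⊆ (Finset.Icc 1 (k + 2)).erase (j.1 + 2) ↔ i = j
    constructor
    · intro h
      by_contra hne
      exact Finset.notMem_erase _ _ (h (Finset.mem_erase.2
        ⟨fun h => hne (Fin.ext (by omega)), hpt j⟩))
    · rintro rfl
      exact subset_rfl

theorem standardExampleNumber_tailGeometry {k n : ℕ} (hk : 1 ≤ k) (hkn : k + 2 ≤ n) :
    standardExampleNumber (tailGeometry k n) = k + 1 := by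
  refine IsGreatest.csSup_eq ⟨Or.inr ⟨by omega, nonempty_standardExample_embedding hk hkn⟩, ?_⟩
  rintro t (rfl | ⟨-, ⟨f⟩⟩)
  · omega
  · obtain ⟨S, hS, rfl⟩ :=
      (isConvexGeometry_tailGeometry k (by omega : 1 ≤ n)).exists_shatters_card_eq f
    exact card_le_of_shatters hS

/-! ### Priority extensions and upper bounds -/

/-- Compare sets by the largest element of `R` on which they differ, and then by the largest
element on which they differ. -/
def PriorityLE {P : Finset (Finset ℕ)} (R : Finset ℕ) (A B : P) : Prop :=
  toLex (toColex (A.1 ∩ R), toColex A.1) ≤ toLex (toColex (B.1 ∩ R), toColex B.1)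

/-- Colex order extends inclusion, hence so does the lexicographic pair; the second coordinate
separates sets with the same trace on R. -/
theorem isLinearExtension_priorityLE {P : Finset (Finset ℕ)} (R : Finset ℕ) :
    IsLinearExtension (PriorityLE (P := P) R) := by
  refine IsLinearExtension.of_monotone_injective
    (f := fun A : P => toLex (toColex (A.1 ∩ R), toColex A.1)) (fun A B hAB => ?_) fun A B h => ?_
  · have hAB' : A.1 ⊆ B.1 := hAB
    exact Prod.Lex.toLex_mono ⟨Finset.Colex.toColex_le_toColex_of_subset
      (Finset.inter_subset_inter_right hAB'), Finset.Colex.toColex_le_toColex_of_subset hAB'⟩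
  · have h' : (toColex (A.1 ∩ R), toColex A.1) = (toColex (B.1 ∩ R), toColex B.1) := h
    exact Subtype.ext (toColex_inj.1 (Prod.ext_iff.1 h').2)

/-- Inside R, the set B has nothing above x and misses x, so the largest difference there belongs to
A. -/
theorem priorityLE_of_mem {P : Finset (Finset ℕ)} {R : Finset ℕ} {A B : P} {x : ℕ}
    (hxA : x ∈ A.1) (hxB : x ∉ B.1) (hxR : x ∈ R)
    (hR : Disjoint (B.1.filter (x < ·)) R) : PriorityLE R B A := by
  refine Prod.Lex.toLex_le_toLex.2 (Or.inl (Finset.Colex.toColex_lt_toColex.2 ⟨fun h => ?_, ?_⟩))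
  · have : x ∈ B.1 ∩ R := h ▸ Finset.mem_inter.2 ⟨hxA, hxR⟩
    exact hxB (Finset.mem_of_mem_inter_left this)
  · intro y hy _
    rw [Finset.mem_inter] at hy
    refine ⟨x, Finset.mem_inter.2 ⟨hxA, hxR⟩, fun h => hxB (Finset.mem_of_mem_inter_left h), ?_⟩
    by_contra hlt
    exact Finset.disjoint_left.1 hR (Finset.mem_filter.2 ⟨hy.1, not_le.1 hlt⟩) hy.2

theorem isRealizer_priorityLE {k n t : ℕ} (R : Fin t → Finset ℕ)
    (h : ∀ x ∈ Finset.Icc 1 n, ∀ T ⊆ Finset.Icc 1 n, (∀ y ∈ T, x < y) → T.card ≤ k →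
      ∃ i, x ∈ R i ∧ Disjoint T (R i)) :
    IsRealizer fun i => PriorityLE (P := tailGeometry k n) (R i) := by
  refine isRealizer_of_forall_not_le (fun i => isLinearExtension_priorityLE _) fun A B hAB => ?_
  obtain ⟨x, hxA, hxB⟩ := Finset.not_subset.1 (show ¬ A.1 ⊆ B.1 from hAB)
  have hB := mem_tailGeometry.1 B.2
  have hx := (mem_tailGeometry.1 A.2).1 hxA
  obtain ⟨i, hi, hdisj⟩ := h x hx (B.1.filter (x < ·)) ((Finset.filter_subset _ _).trans hB.1)
    (fun y hy => (Finset.mem_filter.1 hy).2) (hB.2 x hx hxB)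
  exact ⟨i, priorityLE_of_mem hxA hxB hi hdisj⟩

/-- The number of subsets of `X` that contain `x` and avoid `T`. -/
theorem card_filter_powerset_mem_disjoint {α : Type*} [DecidableEq α] {X T : Finset α} {x : α}
    (hx : x ∈ X) (hT : T ⊆ X) (hxT : x ∉ T) :
    (X.powerset.filter fun R => x ∈ R ∧ Disjoint T R).card = 2 ^ (X.card - (T.card + 1)) := by
  have heq : (X.powerset.filter fun R => x ∈ R ∧ Disjoint T R) = Finset.Icc {x} (X \ T) := by
    ext R
    rw [Finset.mem_filter, Finset.mem_powerset, Finset.mem_Icc,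
      Finset.singleton_subset_iff, Finset.subset_sdiff, disjoint_comm]
    tauto
  rw [heq, Finset.card_Icc_finset (by simp [hx, hxT]), Finset.card_sdiff_of_subset hT,
    Finset.card_singleton]
  rw [Nat.sub_sub]

/-- Each non-empty R gets weight 2^-(n-k-1). Every required reversal is achieved by at least
2^(n-k-1) of them, and the total is (2^n - 1) / 2^(n-k-1); discarding ∅, which reverses nothing
required, makes the bound strict. -/
theorem fractionalDim_tailGeometry_lt {k n : ℕ} (hkn : k + 2 ≤ n) :
    fractionalDim (tailGeometry k n) < 2 ^ (k + 1) := by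
  classical
  set X := Finset.Icc 1 n with hX
  have hXcard : X.card = n := by simp [hX]
  set opts := X.powerset.erase ∅
  have hopts : opts.card = 2 ^ n - 1 := by
    rw [Finset.card_erase_of_mem (by simp), Finset.card_powerset, hXcard]
  set w : ℝ := 2 ^ (n - (k + 1)) with hw
  have hwpos : 0 < w := by positivity
  let L : Finset ℕ → tailGeometry k n → tailGeometry k n → Prop := fun R => PriorityLE R
  have hL : ∀ R, L R ∈ linearExtensions (tailGeometry k n) := fun R => by
    simpa [linearExtensions] using isLinearExtension_priorityLE R
  -- Different R may induce the same extension, so weights are summed over fibres.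
  let f : (tailGeometry k n → tailGeometry k n → Prop) → ℝ := fun r =>
    (opts.filter fun R => L R = r).card / w
  have hsum : ∀ p : (tailGeometry k n → tailGeometry k n → Prop) → Prop,
      ∑ r ∈ (linearExtensions (tailGeometry k n)).filter p, f r =
        ((opts.filter fun R => p (L R)).card : ℝ) / w := fun p => by
    rw [← Finset.sum_div, ← Nat.cast_sum]
    congr 2
    rw [Finset.card_eq_sum_card_fiberwise (f := L)
      (t := (linearExtensions (tailGeometry k n)).filter p)]
    · refine Finset.sum_congr rfl fun r hr => ?_
      congr 1
      ext R
      simp only [Finset.mem_filter]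
      refine ⟨fun h => ⟨⟨h.1, ?_⟩, h.2⟩, fun h => ⟨h.1.1, h.2⟩⟩
      rw [h.2]
      exact (Finset.mem_filter.1 hr).2
    · intro R hR
      exact Finset.mem_coe.2 (Finset.mem_filter.2 ⟨hL R, (Finset.mem_filter.1 hR).2⟩)
  have htotal : ∑ r ∈ linearExtensions (tailGeometry k n), f r = (2 ^ n - 1) / w := by
    have h := hsum fun _ => True
    rw [Finset.filter_true, Finset.filter_true, hopts, Nat.cast_sub Nat.one_le_two_pow] at h
    simpa using h
  have hpow : (2 : ℝ) ^ n = 2 ^ (k + 1) * w := by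
    rw [hw, ← pow_add]
    congr 1
    omega
  have hle : fractionalDim (tailGeometry k n) ≤ (2 ^ n - 1) / w := by
    refine csInf_le ⟨1, fun t ht => ht.1⟩ ⟨?_, f, ⟨fun r _ => by positivity, ?_⟩, htotal⟩
    · rw [le_div_iff₀ hwpos, hpow]
      have h2 : (2 : ℝ) ≤ 2 ^ (k + 1) := by
        simpa using pow_le_pow_right₀ (one_le_two : (1 : ℝ) ≤ 2) (by omega : 1 ≤ k + 1)
      have hw1 : 1 ≤ w := one_le_pow₀ one_le_two
      nlinarith
    · intro A B hAB _
      obtain ⟨x, hxA, hxB⟩ := Finset.not_subset.1 (show ¬ A.1 ⊆ B.1 from hAB)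
      have hB := mem_tailGeometry.1 B.2
      have hx := (mem_tailGeometry.1 A.2).1 hxA
      rw [hsum, le_div_iff₀ hwpos, one_mul]
      have hsub : (X.powerset.filter fun R => x ∈ R ∧ Disjoint (B.1.filter (x < ·)) R) ⊆
          opts.filter fun R => L R B A := by
        intro R hR
        rw [Finset.mem_filter] at hR
        exact Finset.mem_filter.2
          ⟨Finset.mem_erase.2 ⟨Finset.ne_empty_of_mem hR.2.1, hR.1⟩,
            priorityLE_of_mem hxA hxB hR.2.1 hR.2.2⟩
      have hcard := Finset.card_le_card hsub
      rw [card_filter_powerset_mem_disjoint hx ((Finset.filter_subset _ _).trans hB.1) (by simp),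
        hXcard] at hcard
      have hk := hB.2 x hx hxB
      have : (2 ^ (n - (k + 1)) : ℕ) ≤ 2 ^ (n - ((B.1.filter (x < ·)).card + 1)) :=
        Nat.pow_le_pow_right (by norm_num) (by omega)
      rw [hw]
      exact_mod_cast this.trans hcard
  refine hle.trans_lt ?_
  rw [div_lt_iff₀ hwpos, ← hpow]
  linarith

/-- There are few subsets of `{1, …, n}` that separate every point from every `k`-set. -/
theorem exists_separating_family {k n : ℕ} (hkn : k + 2 ≤ n) :
    ∃ t : ℕ, 1 ≤ t ∧ (t : ℝ) ≤ (k + 1) * 2 ^ (k + 2) * Real.log n ∧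
      ∃ R : Fin t → Finset ℕ, ∀ x ∈ Finset.Icc 1 n, ∀ T ⊆ Finset.Icc 1 n, x ∉ T → T.card ≤ k →
        ∃ i, x ∈ R i ∧ Disjoint T (R i) := by
  classical
  set X := Finset.Icc 1 n with hX
  have hXcard : X.card = n := by simp [hX]
  -- Half of the claimed bound: since y ≥ 1, rounding up to ⌊y⌋ + 1 stays below 2y.
  set y : ℝ := (k + 1) * 2 ^ (k + 1) * Real.log n with hy
  have hlog : (1 : ℝ) / 2 ≤ Real.log n := by
    have h2n : (2 : ℝ) ≤ n := by exact_mod_cast (by omega : 2 ≤ n)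
    have := Real.log_le_log two_pos h2n
    have := Real.log_two_gt_d9
    linarith
  have hy1 : 1 ≤ y := by
    have h2 : (2 : ℝ) ≤ 2 ^ (k + 1) := by
      simpa using pow_le_pow_right₀ (one_le_two : (1 : ℝ) ≤ 2) (by omega : 1 ≤ k + 1)
    have hk : (1 : ℝ) ≤ k + 1 := by linarith [(Nat.cast_nonneg k : (0 : ℝ) ≤ k)]
    have : (2 : ℝ) ≤ (k + 1) * 2 ^ (k + 1) := by nlinarith
    rw [hy]
    nlinarith
  refine ⟨⌊y⌋₊ + 1, by omega, ?_, ?_⟩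
  · have := Nat.floor_le (zero_le_one.trans hy1)
    push_cast
    have h2y : (k + 1) * 2 ^ (k + 2) * Real.log n = 2 * y := by rw [hy]; ring
    linarith
  set dem := (X ×ˢ X.powersetCard k).filter fun d => d.1 ∉ d.2
  have hdem : (dem.card : ℝ) ≤ n ^ (k + 1) := by
    have h1 : dem.card ≤ n * n.choose k := by
      refine (Finset.card_filter_le _ _).trans ?_
      rw [Finset.card_product, Finset.card_powersetCard, hXcard]
    have h2 : n * n.choose k ≤ n ^ (k + 1) := by
      rw [pow_succ']
      exact Nat.mul_le_mul_left _ (Nat.choose_le_pow n k)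
    exact_mod_cast h1.trans h2
  set p : ℝ := 1 / 2 ^ (k + 1) with hp
  have hp0 : 0 < p := by positivity
  have hp1 : p ≤ 1 := by
    rw [hp, div_le_one (by positivity)]
    exact one_le_pow₀ one_le_two
  obtain ⟨R, -, hR⟩ := exists_options_card_unsatisfied_le X.powerset
    ⟨∅, Finset.empty_mem_powerset _⟩ dem
    (fun R d => d.1 ∈ R ∧ Disjoint d.2 R) hp1 (fun d hd => by
      simp only [dem, Finset.mem_filter, Finset.mem_product, Finset.mem_powersetCard] at hd
      rw [card_filter_powerset_mem_disjoint hd.1.1 hd.1.2.1 hd.2, Finset.card_powerset, hXcard,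
        hd.1.2.2, hp]
      push_cast
      rw [one_div_mul_eq_div, div_le_iff₀ (by positivity), ← pow_add]
      exact (pow_le_pow_right₀ one_le_two (by omega))) (⌊y⌋₊ + 1)
  -- The choice of y makes exp(-p y) n^(k+1) equal to 1, and ⌊y⌋ + 1 > y makes the inequality
  -- strict, so fewer than one demand is left.
  have hlt : (1 - p) ^ (⌊y⌋₊ + 1) * (dem.card : ℝ) < 1 := by
    have hn0 : (0 : ℝ) < n := by exact_mod_cast (by omega : 0 < n)
    have h1 : (1 - p) ^ (⌊y⌋₊ + 1) ≤ Real.exp (-(p * (⌊y⌋₊ + 1 : ℕ))) := by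
      calc (1 - p) ^ (⌊y⌋₊ + 1) ≤ Real.exp (-p) ^ (⌊y⌋₊ + 1) :=
            pow_le_pow_left₀ (sub_nonneg.2 hp1) (Real.one_sub_le_exp_neg p) _
        _ = _ := by rw [← Real.exp_nat_mul]; congr 1; ring
    have h2 : Real.exp (-(p * (⌊y⌋₊ + 1 : ℕ))) < Real.exp (-(p * y)) := by
      refine Real.exp_lt_exp.2 (neg_lt_neg (mul_lt_mul_of_pos_left ?_ hp0))
      exact_mod_cast Nat.lt_floor_add_one y
    have h3 : p * y = (k + 1 : ℕ) * Real.log n := by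
      rw [hp, hy]; push_cast; field_simp
    have h4 : Real.exp (-(p * y)) * (n : ℝ) ^ (k + 1) = 1 := by
      rw [h3, Real.exp_neg, Real.exp_nat_mul, Real.exp_log hn0]
      exact inv_mul_cancel₀ (by positivity)
    calc (1 - p) ^ (⌊y⌋₊ + 1) * (dem.card : ℝ)
        ≤ Real.exp (-(p * (⌊y⌋₊ + 1 : ℕ))) * (n : ℝ) ^ (k + 1) := by gcongr
      _ < Real.exp (-(p * y)) * (n : ℝ) ^ (k + 1) :=
          mul_lt_mul_of_pos_right h2 (by positivity)
      _ = 1 := h4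
  have hempty : (dem.filter fun d => ∀ i, ¬ (d.1 ∈ R i ∧ Disjoint d.2 (R i))).card = 0 := by
    have := hR.trans_lt hlt
    exact Nat.lt_one_iff.1 (by exact_mod_cast this)
  rw [Finset.card_eq_zero, Finset.filter_eq_empty_iff] at hempty
  refine ⟨R, fun x hx T hT hxT hcard => ?_⟩
  -- Demands only involve sets of size exactly k, so a smaller T is first enlarged away from x.
  obtain ⟨T', hTT', hT', hcard'⟩ := Finset.exists_subsuperset_card_eq
    (show T ⊆ X.erase x from Finset.subset_erase.2 ⟨hT, hxT⟩) hcard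
    (by rw [Finset.card_erase_of_mem hx, hXcard]; omega)
  have := hempty (x := (x, T')) (by
    simp only [dem, Finset.mem_filter, Finset.mem_product, Finset.mem_powersetCard]
    exact ⟨⟨hx, (Finset.subset_erase.1 hT').1, hcard'⟩, (Finset.subset_erase.1 hT').2⟩)
  simp only [not_forall, not_not] at this
  obtain ⟨i, hi, hdisj⟩ := this
  exact ⟨i, hi, hdisj.mono_left hTT'⟩

theorem exists_isRealizer_tailGeometry {k n : ℕ} (hkn : k + 2 ≤ n) :
    ∃ t : ℕ, 1 ≤ t ∧ (t : ℝ) ≤ (k + 1) * 2 ^ (k + 2) * Real.log n ∧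
      ∃ L : Fin t → tailGeometry k n → tailGeometry k n → Prop, IsRealizer L := by
  obtain ⟨t, ht, hle, R, hR⟩ := exists_separating_family hkn
  exact ⟨t, ht, hle, _, isRealizer_priorityLE R fun x hx T hT hlt hcard =>
    hR x hx T hT (fun h => lt_irrefl _ (hlt x h)) hcard⟩

theorem posetDim_tailGeometry_le {k n : ℕ} (hkn : k + 2 ≤ n) :
    (posetDim (tailGeometry k n) : ℝ) ≤ (k + 1) * 2 ^ (k + 2) * Real.log n := by
  obtain ⟨t, ht, hle, L, hL⟩ := exists_isRealizer_tailGeometry hkn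
  exact le_trans (by exact_mod_cast posetDim_le ht hL) hle

/-- For x < y, some binary digit is 0 in x - 1 and 1 in y - 1. For empty T, the all-ones number 2^s
- 1 plays the role of y - 1, which needs x < 2^s. -/
theorem exists_isRealizer_tailGeometry_one {n s : ℕ} (hs : n < 2 ^ s) :
    ∃ L : Fin s → tailGeometry 1 n → tailGeometry 1 n → Prop, IsRealizer L := by
  classical
  refine ⟨_, isRealizer_priorityLE
    (fun i => (Finset.Icc 1 n).filter fun x => (x - 1).testBit i = false) fun x hx T hT hlt hcard => ?_⟩
  have hx' := Finset.mem_Icc.1 hx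
  have key : ∀ z, x ≤ z → z < 2 ^ s → ∃ i : Fin s, (x - 1).testBit i = false ∧
      z.testBit i = true := by
    intro z hxz hz
    by_contra! h
    refine absurd (Nat.le_of_testBit (n := z) (m := x - 1) fun i hi => ?_) (by omega)
    have his : i < s := by
      by_contra hsi
      rw [Nat.testBit_lt_two_pow (hz.trans_le (Nat.pow_le_pow_right (by norm_num)
        (not_lt.1 hsi)))] at hi
      exact absurd hi (by simp)
    by_contra hne
    exact h ⟨i, his⟩ (by simpa using hne) hi
  rcases T.eq_empty_or_nonempty with rfl | ⟨y, hy⟩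
  · obtain ⟨i, hi, -⟩ := key (2 ^ s - 1) (by omega) (by omega)
    exact ⟨i, Finset.mem_filter.2 ⟨hx, hi⟩, by simp⟩
  · have hTy : T = {y} := Finset.eq_singleton_iff_unique_mem.2
      ⟨hy, fun z hz => Finset.card_le_one.1 hcard z hz y hy⟩
    have hyn := Finset.mem_Icc.1 (hT hy)
    have hxy := hlt y hy
    obtain ⟨i, hi, hi'⟩ := key (y - 1) (by omega) (by omega)
    refine ⟨i, Finset.mem_filter.2 ⟨hx, hi⟩, ?_⟩
    rw [hTy, Finset.disjoint_singleton_left, Finset.mem_filter, hi']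
    simp

/-! ### Lower bounds for the dimensions -/

/-- The member `({1, …, a} ∪ {b}) ∩ {1, …, n}` of the geometry. -/
def initialWithPoint (k n : ℕ) (hk : 1 ≤ k) (a b : ℕ) : tailGeometry k n :=
  ⟨(Finset.Icc 1 a ∪ {b}) ∩ Finset.Icc 1 n, mem_tailGeometry.2
    ⟨Finset.inter_subset_right, fun x hx hxA => by
      refine le_trans (Finset.card_le_card (t := {b}) fun y hy => ?_) ((Finset.card_singleton b).trans_le hk)
      simp only [Finset.mem_inter, Finset.mem_union, Finset.mem_Icc, Finset.mem_singleton,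
        Finset.mem_filter] at hx hxA hy ⊢
      omega⟩⟩

theorem mem_initialWithPoint {k n : ℕ} {hk : 1 ≤ k} {a b x : ℕ} :
    x ∈ (initialWithPoint k n hk a b).1 ↔ (1 ≤ x ∧ x ≤ a ∨ x = b) ∧ 1 ≤ x ∧ x ≤ n := by
  simp only [initialWithPoint, Finset.mem_inter, Finset.mem_union, Finset.mem_Icc,
    Finset.mem_singleton]

theorem initialWithPoint_le {k n : ℕ} {hk : 1 ≤ k} {a b c d : ℕ} (hac : a ≤ c)
    (hbd : b ≤ c ∨ b = d) : initialWithPoint k n hk a b ≤ initialWithPoint k n hk c d := by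
  intro x hx
  rw [mem_initialWithPoint] at *
  omega

theorem not_initialWithPoint_le {k n : ℕ} {hk : 1 ≤ k} {a b c d : ℕ} (hb : 1 ≤ b) (hbn : b ≤ n)
    (hcb : c < b) (hbd : b ≠ d) : ¬ initialWithPoint k n hk a b ≤ initialWithPoint k n hk c d := by
  intro h
  have := mem_initialWithPoint.1 (h (mem_initialWithPoint.2 ⟨Or.inr rfl, hb, hbn⟩))
  omega

/-- Colour x < y by an extension with {1, …, x-1} ∪ {y} below {x}. If (x, y) and (y, z) share a
colour, then {y} ⊆ {1, …, x-1} ∪ {y} < {x} ⊆ {1, …, y-1} ∪ {z} < {y} in it, a cycle. Since the point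
n + 1 is truncated away, it may serve as an upper end, giving n + 1 rather than n. -/
theorem add_one_le_two_pow_of_isRealizer {k n t : ℕ} (hk : 1 ≤ k)
    {L : Fin t → tailGeometry k n → tailGeometry k n → Prop} (hL : IsRealizer L) :
    n + 1 ≤ 2 ^ t := by
  rcases Nat.eq_zero_or_pos n with rfl | hn
  · simpa using Nat.one_le_two_pow
  let F := initialWithPoint k n hk
  have hex : ∀ x y, 1 ≤ x → x < y → y ≤ n + 1 → ∃ i, L i (F (x - 1) y) (F 0 x) :=
    fun x y hx hxy hy => hL.exists_rel (not_initialWithPoint_le hx (by omega) (by omega) hxy.ne)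
  have : Nonempty (Fin t) := ⟨(hex 1 2 le_rfl (by omega) (by omega)).choose⟩
  choose! c hc using hex
  have h := le_two_pow_of_shift_coloring (N := n + 1) c fun x y z hx hxy hyz hz heq => ?_
  · simpa using h
  have h₁ := hc x y hx hxy (by omega)
  have h₂ := hc y z (by omega) hyz hz
  rw [← heq] at h₂
  have hlin := hL.1 (c x y)
  have h₃ : L (c x y) (F 0 y) (F (y - 1) z) := by
    refine hlin.1.trans _ (F (x - 1) y) _
      (hlin.2 _ _ (initialWithPoint_le (by omega) (Or.inr rfl))) ?_
    refine hlin.1.trans _ _ _ h₁ (hlin.2 _ _ (initialWithPoint_le (by omega) (Or.inl (by omega))))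
  exact not_initialWithPoint_le (by omega) (by omega) (by omega) hyz.ne
    (hlin.1.antisymm _ _ h₃ h₂).le

theorem posetDim_tailGeometry_one {n : ℕ} (hn : 3 ≤ n) :
    posetDim (tailGeometry 1 n) = 1 + ⌊Real.logb 2 n⌋₊ := by
  have hfloor : ⌊Real.logb 2 n⌋₊ = Nat.log 2 n := by
    exact_mod_cast Real.natFloor_logb_natCast 2 n
  rw [hfloor]
  have hlt : n < 2 ^ (1 + Nat.log 2 n) := by
    rw [add_comm]
    exact Nat.lt_pow_succ_log_self (by norm_num) n
  obtain ⟨L, hL⟩ := exists_isRealizer_tailGeometry_one hlt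
  refine le_antisymm (posetDim_le (by omega) hL) ?_
  obtain ⟨L', hL'⟩ := exists_isRealizer_posetDim (by omega) hL
  have h := add_one_le_two_pow_of_isRealizer le_rfl hL'
  have := Nat.log_lt_of_lt_pow (by omega) (show n < 2 ^ posetDim (tailGeometry 1 n) by omega)
  omega

theorem tendsto_posetDim_tailGeometry {k : ℕ} (hk : 1 ≤ k) :
    Tendsto (fun n => posetDim (tailGeometry k n)) atTop atTop := by
  refine tendsto_atTop_of_eventually_ne fun t => ?_
  filter_upwards [eventually_ge_atTop (2 ^ t), eventually_ge_atTop (k + 2)] with n hn hkn heq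
  obtain ⟨s, hs, -, L, hL⟩ := exists_isRealizer_tailGeometry hkn
  obtain ⟨L', hL'⟩ := exists_isRealizer_posetDim hs hL
  have := add_one_le_two_pow_of_isRealizer hk hL'
  rw [heq] at this
  omega

/-- By Ramsey all crossing pairs have one query string c. If X crosses Y and Y crosses Z,
transitivity in each order, in either direction, gives (X, Z) the string c as well; but X < Z while
X and Y are incomparable. -/
theorem eventually_not_isBooleanRealizer {k : ℕ} (hk : 1 ≤ k) (t : ℕ) :
    ∀ᶠ n in atTop, ∀ L : Fin t → tailGeometry k n → tailGeometry k n → Prop,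
      ¬ IsBooleanRealizer L := by
  obtain ⟨N, hN⟩ := exists_increasing_monochromatic (κ := Fin t → Prop) 6
  filter_upwards [eventually_ge_atTop N] with n hn
  rintro L ⟨hlin, τ, hτ⟩
  let F := initialWithPoint k n hk
  obtain ⟨p, hp, hlt, c, hc⟩ := hN n hn fun a c b d i => L i (F a b) (F c d)
  have h01 := hlt 0 1 (by omega) (by omega)
  have h12 := hlt 1 2 (by omega) (by omega)
  have h23 := hlt 2 3 (by omega) (by omega)
  have h34 := hlt 3 4 (by omega) (by omega)
  have h45 := hlt 4 5 (by omega) (by omega)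
  have h5 := Finset.mem_Icc.1 (hp 5 (by omega))
  have h0 := Finset.mem_Icc.1 (hp 0 (by omega))
  have hXY := hc 0 1 2 4 (by omega) (by omega) (by omega) (by omega)
  have hYZ := hc 1 3 4 5 (by omega) (by omega) (by omega) (by omega)
  have hnXY : ¬ F (p 0) (p 2) ≤ F (p 1) (p 4) :=
    not_initialWithPoint_le (by omega) (by omega) (by omega) (by omega)
  have hleXZ : F (p 0) (p 2) ≤ F (p 3) (p 5) := initialWithPoint_le (by omega) (by omega)
  have hnZX : ¬ F (p 3) (p 5) ≤ F (p 0) (p 2) :=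
    not_initialWithPoint_le (by omega) (by omega) (by omega) (by omega)
  generalize F (p 0) (p 2) = X at *
  generalize F (p 1) (p 4) = Y at *
  generalize F (p 3) (p 5) = Z at *
  have hneXZ : X ≠ Z := fun h => hnZX h.ge
  have hXZ : (fun i => L i X Z) = c := by
    funext i
    have h₁ := congrFun hXY i
    have h₂ := congrFun hYZ i
    refine propext ⟨fun h => ?_, fun h => (hlin i).trans _ _ _ (h₁.mpr h) (h₂.mpr h)⟩
    by_contra hci
    have h₁' := ((hlin i).total X Y).resolve_left fun h => hci (h₁.mp h)
    have h₂' := ((hlin i).total Y Z).resolve_left fun h => hci (h₂.mp h)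
    exact hneXZ ((hlin i).antisymm _ _ h ((hlin i).trans _ _ _ h₂' h₁'))
  have hmem := (hτ X Z hneXZ).1 (lt_of_le_of_ne hleXZ hneXZ)
  rw [hXZ, ← hXY] at hmem
  exact hnXY ((hτ X Y fun h => hnXY h.le).2 hmem).le

theorem tendsto_booleanDim_tailGeometry {k : ℕ} (hk : 1 ≤ k) :
    Tendsto (fun n => booleanDim (tailGeometry k n)) atTop atTop := by
  refine tendsto_atTop_of_eventually_ne fun t => ?_
  filter_upwards [eventually_not_isBooleanRealizer hk t, eventually_ge_atTop (k + 2)]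
    with n hn hkn heq
  obtain ⟨s, hs, -, L, hL⟩ := exists_isRealizer_tailGeometry hkn
  obtain ⟨L', hL'⟩ := exists_isBooleanRealizer_booleanDim hs hL
  subst heq
  exact hn L' hL'

/-- Each element labels injectively the members containing it, and a crossing pair is coloured by
the two labels of a member reversing it. With constant colours, pairs sharing an element in the same
position are reversed in the same member. As Y is second in (X, Y) but first in (Y, Z), the element
W links them through (X, W) and (Y, W). One member then has Z ≤ Y ≤ X although X < Z. -/
theorem eventually_not_isLocalRealizer {k : ℕ} (hk : 1 ≤ k) (r : ℕ) :
    ∀ᶠ n in atTop, ∀ (m : ℕ) (M : Fin m → PartialLinearExtension (tailGeometry k n)),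
      IsLocalRealizer M → ¬ ∀ A, {i : Fin m | A ∈ (M i).carrier}.ncard ≤ r := by
  obtain ⟨N, hN⟩ := exists_increasing_monochromatic (κ := Fin (r + 1) × Fin (r + 1)) 7
  filter_upwards [eventually_ge_atTop N] with n hn
  intro m M hM hr
  let F := initialWithPoint k n hk
  have : Nonempty (Fin m) := ⟨(hM.1 (F 0 0) (F 0 0) le_rfl).choose⟩
  -- Using r + 1 labels keeps the label type inhabited when r = 0.
  have hinj : ∀ A, ∃ e : Fin m → Fin (r + 1), Set.InjOn e {i : Fin m | A ∈ (M i).carrier} := by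
    intro A
    obtain ⟨e, -, he⟩ := (Set.toFinite {i : Fin m | A ∈ (M i).carrier}).exists_injOn_of_encard_le
      (t := (Set.univ : Set (Fin (r + 1)))) (by
        rw [← (Set.toFinite _).cast_ncard_eq, ← (Set.toFinite _).cast_ncard_eq, Set.ncard_univ,
          Nat.card_fin]
        exact_mod_cast (hr A).trans (Nat.le_succ r))
    exact ⟨e, he⟩
  choose e he using hinj
  have hrev := hM.2
  choose! j hj using hrev
  obtain ⟨p, hp, hlt, c, hc⟩ := hN n hn fun a c b d =>
    (e (F a b) (j (F a b) (F c d)), e (F c d) (j (F a b) (F c d)))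
  have h01 := hlt 0 1 (by omega) (by omega)
  have h12 := hlt 1 2 (by omega) (by omega)
  have h23 := hlt 2 3 (by omega) (by omega)
  have h34 := hlt 3 4 (by omega) (by omega)
  have h45 := hlt 4 5 (by omega) (by omega)
  have h56 := hlt 5 6 (by omega) (by omega)
  have h6 := Finset.mem_Icc.1 (hp 6 (by omega))
  have h0 := Finset.mem_Icc.1 (hp 0 (by omega))
  have hcross : ∀ a c b d, a < c → c < b → b < d → 1 ≤ a → d ≤ n →
      (M (j (F a b) (F c d))).Rel (F c d) (F a b) := fun a c b d h₁ h₂ h₃ h₄ h₅ =>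
    hj _ _ (not_initialWithPoint_le (by omega) (by omega) (by omega) (by omega))
      (not_initialWithPoint_le (by omega) (by omega) (by omega) (by omega))
  have cXY := hc 0 1 3 5 (by omega) (by omega) (by omega) (by omega)
  have cXW := hc 0 2 3 6 (by omega) (by omega) (by omega) (by omega)
  have cYW := hc 1 2 5 6 (by omega) (by omega) (by omega) (by omega)
  have cYZ := hc 1 4 5 6 (by omega) (by omega) (by omega) (by omega)
  have rXY := hcross (p 0) (p 1) (p 3) (p 5) (by omega) (by omega) (by omega) (by omega) (by omega)
  have rXW := hcross (p 0) (p 2) (p 3) (p 6) (by omega) (by omega) (by omega) (by omega) (by omega)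
  have rYW := hcross (p 1) (p 2) (p 5) (p 6) (by omega) (by omega) (by omega) (by omega) (by omega)
  have rYZ := hcross (p 1) (p 4) (p 5) (p 6) (by omega) (by omega) (by omega) (by omega) (by omega)
  have hleXZ : F (p 0) (p 3) ≤ F (p 4) (p 6) := initialWithPoint_le (by omega) (by omega)
  have hnZX : ¬ F (p 4) (p 6) ≤ F (p 0) (p 3) :=
    not_initialWithPoint_le (by omega) (by omega) (by omega) (by omega)
  generalize F (p 0) (p 3) = X at *
  generalize F (p 1) (p 5) = Y at *
  generalize F (p 2) (p 6) = W at *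
  generalize F (p 4) (p 6) = Z at *
  have e₁ : j X Y = j X W := he X rXY.2.1 rXW.2.1
    ((Prod.ext_iff.1 cXY).1.trans (Prod.ext_iff.1 cXW).1.symm)
  have e₂ : j X W = j Y W := he W rXW.1 rYW.1
    ((Prod.ext_iff.1 cXW).2.trans (Prod.ext_iff.1 cYW).2.symm)
  have e₃ : j Y W = j Y Z := he Y rYW.2.1 rYZ.2.1
    ((Prod.ext_iff.1 cYW).1.trans (Prod.ext_iff.1 cYZ).1.symm)
  rw [← e₃, ← e₂, ← e₁] at rYZ
  obtain ⟨hY, hX, hYX⟩ := rXY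
  obtain ⟨hZ, _, hZY⟩ := rYZ
  have hlin := (M (j X Y)).isLinearExtension
  have heq := hlin.1.antisymm _ _ (hlin.2 ⟨X, hX⟩ ⟨Z, hZ⟩ hleXZ)
    (hlin.1.trans _ _ _ hZY hYX)
  exact hnZX (Subtype.ext_iff.1 heq).ge

theorem tendsto_localDim_tailGeometry {k : ℕ} (hk : 1 ≤ k) :
    Tendsto (fun n => localDim (tailGeometry k n)) atTop atTop := by
  refine tendsto_atTop_of_eventually_ne fun r => ?_
  filter_upwards [eventually_not_isLocalRealizer hk r, eventually_ge_atTop (k + 2)]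
    with n hn hkn heq
  obtain ⟨s, hs, -, L, hL⟩ := exists_isRealizer_tailGeometry hkn
  obtain ⟨m, M, hM, hcard⟩ := exists_isLocalRealizer_localDim hs hL
  exact hn m M hM fun A => heq ▸ hcard A

/-! ### Convex dimension -/

/-- A is its own intersection with the full ground set taken from all other geometries. -/
theorem IsConvexRealizer.mem_of_mem {α : Type*} [DecidableEq α] {X : Finset α}
    {P : Finset (Finset α)} {t : ℕ} {Q : Fin t → Finset (Finset α)} (hQ : IsConvexRealizer X P Q)
    {i : Fin t} {A : Finset α} (hA : A ∈ Q i) : A ∈ P := by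
  have hX : ∀ j, X ∈ Q j ∧ ∀ B ∈ Q j, B ⊆ X := fun j => by
    obtain ⟨l, -, hl, hlQ⟩ := hQ.1 j
    rw [hlQ]
    refine ⟨Finset.mem_image.2 ⟨l.length, by simp, by simpa using hl⟩, fun B hB => ?_⟩
    obtain ⟨s, -, rfl⟩ := Finset.mem_image.1 hB
    rw [← hl]
    exact fun x hx => List.mem_toFinset.2 (List.mem_of_mem_take (List.mem_toFinset.1 hx))
  refine (hQ.2 A).2 ⟨fun j => if j = i then A else X, fun j => ?_, fun x => ⟨fun hx j => ?_,
    fun h => by simpa using h i⟩⟩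
  · dsimp only
    split_ifs with hji
    · exact hji ▸ hA
    · exact (hX j).1
  · dsimp only
    split_ifs
    · exact hx
    · exact (hX i).2 A hA hx

/-- Two members of a linear geometry with equally many elements coincide. -/
theorem IsLinearGeometry.eq_of_card_eq {α : Type*} [DecidableEq α] {X : Finset α}
    {P : Finset (Finset α)} (hP : IsLinearGeometry X P) {A B : Finset α} (hA : A ∈ P) (hB : B ∈ P)
    (h : A.card = B.card) : A = B := by
  obtain ⟨l, hl, -, rfl⟩ := hP
  obtain ⟨i, hi, rfl⟩ := Finset.mem_image.1 hA
  obtain ⟨j, hj, rfl⟩ := Finset.mem_image.1 hB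
  rw [List.toFinset_card_of_nodup (hl.sublist (List.take_sublist _ _)),
    List.toFinset_card_of_nodup (hl.sublist (List.take_sublist _ _)), List.length_take,
    List.length_take] at h
  rw [Finset.mem_range] at hi hj
  rw [show i = j by omega]

/-- Let S be a k-subset of {2, …, n}, written as an intersection. Some factor omits 1; it lies in
the geometry, so it has at most k elements, and as it contains S it equals S. Distinct S need
distinct linear geometries. -/
theorem choose_le_of_isConvexRealizer {k n t : ℕ} (hkn : k + 2 ≤ n)
    {Q : Fin t → Finset (Finset ℕ)}
    (hQ : IsConvexRealizer (Finset.Icc 1 n) (tailGeometry k n) Q) : (n - 1).choose k ≤ t := by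
  have h1n : 1 ∈ Finset.Icc 1 n := Finset.mem_Icc.2 (by omega)
  have hex : ∀ S ∈ (Finset.Icc 2 n).powersetCard k, ∃ i, S ∈ Q i := by
    intro S hS
    obtain ⟨hSX, hcard⟩ := Finset.mem_powersetCard.1 hS
    have h1S : 1 ∉ S := fun h => by
      have := Finset.mem_Icc.1 (hSX h)
      omega
    have hSP : S ∈ tailGeometry k n := mem_tailGeometry.2
      ⟨hSX.trans (Finset.Icc_subset_Icc_left one_le_two), fun x _ _ =>
        (Finset.card_filter_le _ _).trans hcard.le⟩
    obtain ⟨A, hA, hSA⟩ := (hQ.2 S).1 hSP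
    obtain ⟨i, hi⟩ := not_forall.1 fun h => h1S ((hSA 1).2 h)
    have hAP := mem_tailGeometry.1 (hQ.mem_of_mem (hA i))
    have hle := hAP.2 1 h1n hi
    rw [Finset.filter_true_of_mem fun y hy => lt_of_le_of_ne (Finset.mem_Icc.1 (hAP.1 hy)).1
      fun h => hi (h ▸ hy)] at hle
    rw [Finset.eq_of_subset_of_card_le (fun x hx => (hSA x).1 hx i) (hle.trans hcard.ge)]
    exact ⟨i, hA i⟩
  have hne : ((Finset.Icc 2 n).powersetCard k).Nonempty := by
    rw [Finset.powersetCard_nonempty, Nat.card_Icc]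
    omega
  have : Nonempty (Fin t) := ⟨(hex _ hne.choose_spec).choose⟩
  choose! c hc using hex
  have h := Finset.card_le_card_of_injOn (t := (Finset.univ : Finset (Fin t))) c (by simp)
    fun S hS T hT hST => (hQ.1 (c S)).eq_of_card_eq (hc S hS) (hST ▸ hc T hT)
      ((Finset.mem_powersetCard.1 hS).2.trans (Finset.mem_powersetCard.1 hT).2.symm)
  rw [Finset.card_powersetCard, Nat.card_Icc, Finset.card_univ, Fintype.card_fin] at h
  simpa using h

/-- The elements of `S` in increasing order, followed by those of `{1, …, n} \ S` in increasing
order. -/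
def frontList (n : ℕ) (S : Finset ℕ) : List ℕ :=
  S.sort (· ≤ ·) ++ (Finset.Icc 1 n \ S).sort (· ≤ ·)

theorem mem_frontList {n : ℕ} {S : Finset ℕ} (hS : S ⊆ Finset.Icc 1 n) {x : ℕ} :
    x ∈ frontList n S ↔ x ∈ Finset.Icc 1 n := by
  rw [frontList, List.mem_append, Finset.mem_sort, Finset.mem_sort, ← Finset.mem_union,
    Finset.union_sdiff_of_subset hS]

theorem nodup_frontList (n : ℕ) (S : Finset ℕ) : (frontList n S).Nodup := by
  refine List.nodup_append.2 ⟨S.sort_nodup _, Finset.sort_nodup _ _, fun x hx y hy hxy => ?_⟩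
  rw [Finset.mem_sort] at hx hy
  exact (Finset.mem_sdiff.1 hy).2 (hxy ▸ hx)

theorem pairwise_frontList (n : ℕ) (S : Finset ℕ) :
    (frontList n S).Pairwise fun u v => (v ∈ S → u ∈ S) ∧ (v ∉ S → u ∈ S ∨ u < v) := by
  refine List.pairwise_append.2 ⟨?_, ?_, fun u hu v hv => ?_⟩
  · refine List.pairwise_of_forall_mem_list fun u hu v hv => ?_
    rw [Finset.mem_sort] at hu hv
    exact ⟨fun _ => hu, fun h => absurd hv h⟩
  · refine (Finset.sortedLT_sort (Finset.Icc 1 n \ S)).pairwise.imp_of_mem fun _ hv huv => ?_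
    rw [Finset.mem_sort] at hv
    exact ⟨fun h => absurd h (Finset.mem_sdiff.1 hv).2, fun _ => Or.inr huv⟩
  · rw [Finset.mem_sort] at hu hv
    exact ⟨fun _ => hu, fun _ => Or.inl hu⟩

/-- Whatever is listed before x and exceeds x belongs to S. -/
theorem take_frontList_mem_tailGeometry {k n : ℕ} {S : Finset ℕ} (hS : S ⊆ Finset.Icc 1 n)
    (hcard : S.card ≤ k) (i : ℕ) : ((frontList n S).take i).toFinset ∈ tailGeometry k n := by
  refine mem_tailGeometry.2 ⟨fun x hx => (mem_frontList hS).1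
    (List.mem_of_mem_take (List.mem_toFinset.1 hx)), fun x hx hxA => ?_⟩
  refine (Finset.card_le_card fun y hy => ?_).trans hcard
  obtain ⟨hy, hxy⟩ := Finset.mem_filter.1 hy
  rw [List.mem_toFinset] at hy hxA
  have hpair := pairwise_frontList n S
  have hx' := (mem_frontList hS).2 hx
  rw [← List.take_append_drop i (frontList n S)] at hpair hx'
  have h := (List.pairwise_append.1 hpair).2.2 y hy x ((List.mem_append.1 hx').resolve_left hxA)
  by_cases hxS : x ∈ S
  · exact h.1 hxS
  · exact (h.2 hxS).resolve_right (by omega)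

/-- The list is cut just before x. An element of B after x would lie outside S, as x does, hence
exceed x, hence lie in S. -/
theorem exists_take_frontList {n x : ℕ} {S B : Finset ℕ} (hS : S ⊆ Finset.Icc 1 n)
    (hB : B ⊆ Finset.Icc 1 n) (hx : x ∈ Finset.Icc 1 n) (hxS : x ∉ S) (hxB : x ∉ B)
    (hBS : B.filter (x < ·) ⊆ S) :
    ∃ i, B ⊆ ((frontList n S).take i).toFinset ∧ x ∉ (frontList n S).take i := by
  obtain ⟨u, v, huv⟩ := List.append_of_mem ((mem_frontList hS).2 hx)
  have hpair := pairwise_frontList n S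
  have hnodup := nodup_frontList n S
  rw [huv] at hpair hnodup
  have hxu : x ∉ u := fun h => (List.nodup_append.1 hnodup).2.2 x h x List.mem_cons_self rfl
  refine ⟨u.length, ?_, by rwa [huv, List.take_left]⟩
  rw [huv, List.take_left]
  intro b hb
  have hbl := (mem_frontList hS).2 (hB hb)
  rw [huv, List.mem_append, List.mem_cons] at hbl
  rw [List.mem_toFinset]
  refine hbl.resolve_right ?_
  rintro (rfl | hbv)
  · exact hxB hb
  · have h := (List.pairwise_cons.1 (List.pairwise_append.1 hpair).2.1).1 b hbv
    by_cases hbS : b ∈ S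
    · exact hxS (h.1 hbS)
    · exact hbS (hBS (Finset.mem_filter.2 ⟨hb, (h.2 hbS).resolve_left hxS⟩))

/-- Each B is the intersection of the shortest prefixes containing it: for x ∉ B, the elements of B
above x extend to a k-set avoiding x, whose list has a prefix that contains B and omits x. -/
theorem exists_isConvexRealizer_tailGeometry {k n : ℕ} (hkn : k + 2 ≤ n) :
    ∃ Q : Fin ((n - 1).choose k) → Finset (Finset ℕ),
      IsConvexRealizer (Finset.Icc 1 n) (tailGeometry k n) Q := by
  classical
  have hcard : ((Finset.Icc 2 n).powersetCard k).card = (n - 1).choose k := by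
    rw [Finset.card_powersetCard, Nat.card_Icc]
    rfl
  let S : Fin ((n - 1).choose k) → Finset ℕ := fun i => ((Finset.equivFinOfCardEq hcard).symm i).1
  have hS : ∀ i, S i ⊆ Finset.Icc 1 n ∧ (S i).card = k := fun i => by
    have h := Finset.mem_powersetCard.1 ((Finset.equivFinOfCardEq hcard).symm i).2
    exact ⟨h.1.trans (Finset.Icc_subset_Icc_left one_le_two), h.2⟩
  have hSsurj : ∀ T ∈ (Finset.Icc 2 n).powersetCard k, ∃ i, S i = T := fun T hT =>
    ⟨Finset.equivFinOfCardEq hcard ⟨T, hT⟩, by simp [S]⟩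
  have hlist : ∀ i, (frontList n (S i)).toFinset = Finset.Icc 1 n := fun i => by
    ext x
    rw [List.mem_toFinset, mem_frontList (hS i).1]
  let Q : Fin ((n - 1).choose k) → Finset (Finset ℕ) := fun i =>
    (Finset.range ((frontList n (S i)).length + 1)).image
      fun j => ((frontList n (S i)).take j).toFinset
  have hQ : ∀ i, ∀ A ∈ Q i, A ∈ tailGeometry k n := fun i A hA => by
    obtain ⟨j, -, rfl⟩ := Finset.mem_image.1 hA
    exact take_frontList_mem_tailGeometry (hS i).1 (hS i).2.le j
  refine ⟨Q, fun i => ⟨_, nodup_frontList n (S i), hlist i, rfl⟩, fun B => ⟨fun hB => ?_, ?_⟩⟩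
  · have hB' := mem_tailGeometry.1 hB
    have hall : ∀ i, B ⊆ ((frontList n (S i)).take (frontList n (S i)).length).toFinset :=
      fun i => by rw [List.take_length, hlist]; exact hB'.1
    have hex : ∀ i, ∃ j, B ⊆ ((frontList n (S i)).take j).toFinset := fun i => ⟨_, hall i⟩
    refine ⟨fun i => ((frontList n (S i)).take (Nat.find (hex i))).toFinset, fun i => ?_,
      fun x => ⟨fun hx i => Nat.find_spec (hex i) hx, fun h => ?_⟩⟩
    · exact Finset.mem_image.2 ⟨_, Finset.mem_range.2 (Nat.lt_succ_of_le
        (Nat.find_le (hall i))), rfl⟩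
    · by_contra hxB
      have hne : Nonempty (Fin ((n - 1).choose k)) :=
        ⟨⟨0, Nat.choose_pos (by omega)⟩⟩
      have hx : x ∈ Finset.Icc 1 n := (mem_tailGeometry.1
        (take_frontList_mem_tailGeometry (hS hne.some).1 (hS hne.some).2.le _)).1 (h hne.some)
      -- Elements above x are at least 2, and {2, …, n} \ {x} has at least n - 2 ≥ k elements, so
      -- there is room for T.
      obtain ⟨T, hBT, hT, hTcard⟩ := Finset.exists_subsuperset_card_eq
        (s := B.filter (x < ·)) (t := (Finset.Icc 2 n).erase x) (fun y hy => by
          have hy' := Finset.mem_filter.1 hy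
          have h₁ := Finset.mem_Icc.1 (hB'.1 hy'.1)
          have h₂ := Finset.mem_Icc.1 hx
          exact Finset.mem_erase.2 ⟨by omega, Finset.mem_Icc.2 (by omega)⟩) (hB'.2 x hx hxB) (by
          have := Finset.pred_card_le_card_erase (s := Finset.Icc 2 n) (a := x)
          rw [Nat.card_Icc] at this
          omega)
      obtain ⟨i, rfl⟩ := hSsurj T (Finset.mem_powersetCard.2
        ⟨hT.trans (Finset.erase_subset _ _), hTcard⟩)
      obtain ⟨j, hBj, hxj⟩ := exists_take_frontList (hS i).1 hB'.1 hx
        (fun hxS => Finset.notMem_erase x _ (hT hxS)) hxB hBT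
      have hle : Nat.find (hex i) ≤ j := Nat.find_le hBj
      exact hxj (List.take_subset_take_left _ hle (List.mem_toFinset.1 (h i)))
  · rintro ⟨A, hA, hBA⟩
    refine mem_tailGeometry.2 ⟨fun x hx => ?_, fun x hx hxB => ?_⟩
    · exact (mem_tailGeometry.1 (hQ ⟨0, Nat.choose_pos (by omega)⟩ _ (hA _))).1 ((hBA x).1 hx _)
    · obtain ⟨i, hi⟩ := not_forall.1 fun h => hxB ((hBA x).2 h)
      exact (Finset.card_le_card (Finset.filter_subset_filter _ fun y hy => (hBA y).1 hy i)).trans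
        ((mem_tailGeometry.1 (hQ i _ (hA i))).2 x hx hi)

theorem convexDim_tailGeometry {k n : ℕ} (hkn : k + 2 ≤ n) :
    convexDim (Finset.Icc 1 n) (tailGeometry k n) = (n - 1).choose k := by
  refine le_antisymm (Nat.sInf_le ⟨Nat.choose_pos (by omega),
    exists_isConvexRealizer_tailGeometry hkn⟩) (le_csInf ⟨_, Nat.choose_pos (by omega),
    exists_isConvexRealizer_tailGeometry hkn⟩ ?_)
  rintro t ⟨-, Q, hQ⟩
  exact choose_le_of_isConvexRealizer hkn hQ

/-! ### The main theorem -/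

/-- The case k = 1 suffices: the standard example number stays 2 while the dimension grows. -/
theorem not_dimBounded_isConvexGeometryPoset : ¬ DimBounded IsConvexGeometryPoset := by
  rintro ⟨f, hf⟩
  obtain ⟨n, hn, hn3⟩ := (((tendsto_posetDim_tailGeometry le_rfl).eventually_gt_atTop (f (1 + 1))).and
    (eventually_ge_atTop 3)).exists
  have h := hf (tailGeometry 1 n) ⟨ℕ, inferInstance, Finset.Icc 1 n, tailGeometry 1 n,
    isConvexGeometry_tailGeometry 1 (by omega), ⟨OrderIso.refl _⟩⟩
  rw [standardExampleNumber_tailGeometry le_rfl hn3] at h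
  omega

theorem theorem1p5 :
    ∃ P : ℕ → ℕ → Finset (Finset ℕ),
      (∀ k n : ℕ, 1 ≤ k → k + 2 ≤ n →
        IsConvexGeometry (Finset.Icc 1 n) (P k n) ∧
        (P k n).vcDim = k + 1 ∧
        standardExampleNumber (P k n) = k + 1 ∧
        fractionalDim (P k n) < 2 ^ (k + 1) ∧
        (posetDim (P k n) : ℝ) ≤ (k + 1) * 2 ^ (k + 2) * Real.log n ∧
        convexDim (Finset.Icc 1 n) (P k n) = (n - 1).choose k) ∧
      (∀ n : ℕ, 3 ≤ n → posetDim (P 1 n) = 1 + ⌊Real.logb 2 n⌋₊) ∧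
      (∀ k : ℕ, 1 ≤ k → Tendsto (fun n => booleanDim (P k n)) atTop atTop) ∧
      (∀ k : ℕ, 1 ≤ k → Tendsto (fun n => localDim (P k n)) atTop atTop) ∧
      (∀ k : ℕ, 1 ≤ k → Tendsto (fun n => posetDim (P k n)) atTop atTop) ∧
      ¬ DimBounded IsConvexGeometryPoset :=
  ⟨tailGeometry, fun k n hk hkn => ⟨isConvexGeometry_tailGeometry k (by omega),
      vcDim_tailGeometry (by omega), standardExampleNumber_tailGeometry hk hkn,
      fractionalDim_tailGeometry_lt hkn, posetDim_tailGeometry_le hkn,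
      convexDim_tailGeometry hkn⟩,
    fun _ hn => posetDim_tailGeometry_one hn, fun _ hk => tendsto_booleanDim_tailGeometry hk,
    fun _ hk => tendsto_localDim_tailGeometry hk, fun _ hk => tendsto_posetDim_tailGeometry hk,
    not_dimBounded_isConvexGeometryPoset⟩
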